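/- Let $G$ be an infinite countable amenable group, $K$ a field, $A$ a finite-dimensional $K$-vector space. Let $G$ act on $A^G$ by $(gx)(h)=x(g^{-1}h)$. Let $\tau\colon A^G\to A^G$ be a linear NUCA (non-uniform cellular automaton) with finite memory, i.e. a $K$-linear map such that, for some finite $M\subset G$ and some maps $s(g)\colon A^M\to A$ $(g\in G)$, $\tau(x)(g)=s(g)\big((g^{-1}x)|_M\big)$ for all $x\in A^G$, $g\in G$. For $U\subset A^G$, $\tau|_U$ is pre-injective if, for all $x,y\in U$ that differ at only finitely many elements of $G$, $\tau(x)=\tau(y)$ implies $x=y$. A Følner net of $G$ is a net $\mathcal F=(F_i)_{i\in I}$ of nonempty finite subsets of $G$, indexed by a nonempty directed set, such that $|F_i\setminus F_ig|/|F_i|\to0$ for every $g\in G$. For $S\subset G$ put $$\overline d_{\mathcal F}(S)=\limsup_{i}\frac{|S\cap F_i|}{|F_i|},\qquad \overline D_{G}(S)=\liminf_{i}\,\sup_{g\in G}\frac{|S\cap gF_i|}{|F_i|},$$ and for a vector subspace $X\subset A^G$, with $X_F=\{x|_F: x\in X\}$, put $$\overline{\mathrm{mdim}}_{\mathcal F}(X)=\limsup_i\frac{\dim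 X_{F_i}}{|F_i|},\qquad \underline{\mathrm{mDim}}(X)=\limsup_i\,\inf_{g\in G}\frac{\dim (gX)_{F_i}}{|F_i|}.$$ (i) If $S\subset G$, $p\in A^S$ and $\tau|_U$ is pre-injective for $U=\{p\}\times A^{G\setminus S}$, then $\overline{\mathrm{mdim}}_{\mathcal F}(\operatorname{im}\tau)\ge(1-\overline d_{\mathcal F}(S))\dim A$ for every Følner net (in particular every Følner sequence) $\mathcal F$ of $G$. (ii) Suppose that $\dim A=1$, $d\in\mathbb R$, and $\underline{\mathrm{mDim}}(\operatorname{im}\tau)>1-d$, where $\underline{\mathrm{mDim}}$ is computed along some Følner net of $G$. Then there is $S\subset G$ such that $\overline D_G(S)\le d$, where $\overline D_G$ may be computed along any Følner net of $G$, and such that $\tau|_U$ is pre-injective for $U=\{0\}^S\times A^{G\setminus S}$. -/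

import Mathlib

open Filter Topology

universe u v

noncomputable section

namespace NUCA

/-! Følner nets and amenability. -/

/-- A net `F` of nonempty finite subsets of `G` is a Følner net if
`|F i \ (F i) g| / |F i| → 0` for every `g`. It is used for directed nonempty `ι` only;
`ι = ℕ` gives Følner sequences. -/
def IsFolnerNet {G : Type*} [Group G] {ι : Type*} [Preorder ι] (F : ι → Finset G) : Prop :=
  (∀ i, (F i).Nonempty) ∧
    ∀ g : G, Tendsto
      (fun i => ((((F i : Set G) \ ((fun h => h * g) '' (F i : Set G))).ncard : ℝ)
        / ((F i).card : ℝ)))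
      atTop (𝓝 0)

/-- A group is amenable if it admits a Følner net. -/
def IsAmenable (G : Type u) [Group G] : Prop :=
  ∃ (ι : Type u) (_ : Preorder ι) (_ : IsDirectedOrder ι) (_ : Nonempty ι) (F : ι → Finset G),
    IsFolnerNet F

/-! Densities. -/

/-- The upper natural density of `S` along `F`. -/
def upperDensity {G : Type*} {ι : Type*} [Preorder ι] (F : ι → Finset G) (S : Set G) : ℝ :=
  limsup (fun i => ((S ∩ (F i : Set G)).ncard : ℝ) / ((F i).card : ℝ)) atTop

/-- The upper Banach density of `S`, computed along `F`:
`liminf_i sup_g |S ∩ g F_i| / |F_i|`. -/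
def upperBanachDensity {G : Type*} [Group G] {ι : Type*} [Preorder ι]
    (F : ι → Finset G) (S : Set G) : ℝ :=
  liminf (fun i => ⨆ g : G,
    ((S ∩ ((fun h => g * h) '' (F i : Set G))).ncard : ℝ) / ((F i).card : ℝ)) atTop

/-! Shift, non-uniform cellular automata, pre-injectivity. -/

/-- The Bernoulli shift: `(g x)(h) = x (g⁻¹ h)`. -/
def shift {G A : Type*} [Group G] (g : G) (x : G → A) : G → A := fun h => x (g⁻¹ * h)

/-- The NUCA with memory `M` and configuration of local transition maps `s`:
`σ_s(x)(g) = s(g)((g⁻¹ x)|_M)`. -/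
def nuca {G A : Type*} [Group G] (M : Set G) (s : G → (M → A) → A) (x : G → A) : G → A :=
  fun g => s g (fun m : M => shift g⁻¹ x m)

/-- `τ` is a NUCA with finite memory. -/
def IsNUCAWithFiniteMemory {G A : Type*} [Group G] (τ : (G → A) → (G → A)) : Prop :=
  ∃ (M : Set G) (s : G → (M → A) → A), M.Finite ∧ τ = nuca M s

/-- Two configurations are asymptotic if they differ at finitely many cells only. -/
def Asymptotic {G A : Type*} (x y : G → A) : Prop := {g | x g ≠ y g}.Finite

/-- The restriction of `τ` to `U` is pre-injective. -/
def PreInjectiveOn {G A : Type*} (τ : (G → A) → (G → A)) (U : Set (G → A)) : Prop :=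
  ∀ x ∈ U, ∀ y ∈ U, Asymptotic x y → τ x = τ y → x = y

/-- The set `{p} × A^(G \ S)` of the configurations that extend `p ∈ A^S`. -/
def cylinder {G A : Type*} (S : Set G) (p : S → A) : Set (G → A) := {x | ∀ g : S, x g = p g}

/-! Mean dimensions of vector subspaces of the full shift. -/

/-- The shift as a linear map on `A^G`. -/
def shiftLinear (K : Type*) {G A : Type*} [Group G] [Field K] [AddCommGroup A] [Module K A]
    (g : G) : (G → A) →ₗ[K] (G → A) where
  toFun := shift g
  map_add' _ _ := rfl
  map_smul' _ _ := rfl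

/-- The restriction to `F` of the configurations in `X`, a vector subspace `X_F` of `A^F`. -/
def restrictTo {K G A : Type*} [Field K] [AddCommGroup A] [Module K A]
    (X : Submodule K (G → A)) (F : Finset G) : Submodule K (F → A) :=
  X.map (LinearMap.funLeft K A (Subtype.val : F → G))

/-- The upper natural mean dimension along `F`: `limsup_i dim X_{F_i} / |F_i|`. -/
def upperMeanDim {K G A : Type*} [Field K] [AddCommGroup A] [Module K A]
    {ι : Type*} [Preorder ι] (F : ι → Finset G) (X : Submodule K (G → A)) : ℝ :=
  limsup (fun i => (Module.finrank K (restrictTo X (F i)) : ℝ) / ((F i).card : ℝ)) atTop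

/-- The lower Banach mean dimension, computed along `F`: the limit of
`inf_g dim (gX)_{F_i} / |F_i|`. The upper limit is used, so that the value makes sense
for every net and is the limit as soon as this exists. -/
def lowerBanachMeanDim {K G A : Type*} [Group G] [Field K] [AddCommGroup A] [Module K A]
    {ι : Type*} [Preorder ι] (F : ι → Finset G) (X : Submodule K (G → A)) : ℝ :=
  limsup (fun i => ⨅ g : G,
    (Module.finrank K (restrictTo (X.map (shiftLinear K g)) (F i)) : ℝ) / ((F i).card : ℝ)) atTop

end NUCA

end

/-! Let `τ` have finite memory `M`, so that `τ x g` depends on `x` on `gM` only. All error terms are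
sizes of boundaries `∂F` of finite sets `F`, each with respect to a fixed finite set (`M`, `M⁻¹`, or
the inverse of an averaging window). They are `o(|F|)` along Følner nets
(`NUCA.IsFolnerNet.tendsto_boundary`).

For the lower bound on the mean dimension of the image, consider a nonzero configuration that is
supported in `F \ S` off the `M⁻¹`-boundary of `F`. Its image is supported in `F`, and is nonzero by
pre-injectivity. Hence `(|F \ S| - |∂F|) dim A ≤ dim (im τ)_F`
(`card_mul_finrank_le_finrank_restrictTo_range`).

The construction of `S` in the second half needs no tiling of `G`. Enumerate `G` and let `S` be the
set of the last cells of the supports of the nonzero finitely supported elements of `ker τ`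
(`leadingCells`). Then `τ` is pre-injective on the configurations that vanish on `S`, because a
nonzero finitely supported element of the kernel is nonzero at its last cell. The crucial point is
that elements with distinct last cells in a window `W` have linearly independent restrictions to `W`,
even though their supports may leave `W`. So `|S ∩ W| ≤ dim (ker τ)_W`
(`card_leadingCells_le_finrank`). Rank-nullity in the window gives
`dim (ker τ)_W + dim (im τ)_W ≤ (|W| + |∂W|) dim A` (`finrank_restrictTo_ker_add_range_le`). For
`dim A = 1`, the assumption on the mean dimension therefore yields one finite `F` with
`|S ∩ gF| ≤ d |F|` for all `g`, and averaging over the translates of `F` bounds the upper Banach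
density of `S` along every Følner net (`upperBanachDensity_le_of_forall_card_le`). -/

open NUCA

/-! ### Boundaries of finite sets -/

open Classical in
/-- The cells `x` of `F` for which `xM` is not contained in `F`. -/
noncomputable def memoryBoundary {G : Type*} [Group G] (M F : Finset G) : Finset G :=
  F.filter fun x => ∃ m ∈ M, x * m ∉ F

theorem mem_memoryBoundary {G : Type*} [Group G] {M F : Finset G} {x : G} :
    x ∈ memoryBoundary M F ↔ x ∈ F ∧ ∃ m ∈ M, x * m ∉ F := by
  simp [memoryBoundary]

theorem card_memoryBoundary_map_mulLeft {G : Type*} [Group G] (M F : Finset G) (g : G) :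
    (memoryBoundary M (F.map (mulLeftEmbedding g))).card = (memoryBoundary M F).card := by
  have h : memoryBoundary M (F.map (mulLeftEmbedding g))
      = (memoryBoundary M F).map (mulLeftEmbedding g) := by
    ext x
    obtain ⟨y, rfl⟩ : ∃ y, g * y = x := ⟨g⁻¹ * x, by simp⟩
    simp [mem_memoryBoundary, mul_assoc]
  rw [h, Finset.card_map]

theorem card_memoryBoundary_le {G : Type*} [Group G] (M F : Finset G) :
    (memoryBoundary M F).card
      ≤ ∑ m ∈ M, ((F : Set G) \ ((fun h => h * m⁻¹) '' (F : Set G))).ncard := by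
  classical
  have h : memoryBoundary M F ⊆ M.biUnion fun m => F.filter fun x => x * m ∉ F := by
    intro x hx
    obtain ⟨hx, m, hm, h⟩ := mem_memoryBoundary.1 hx
    exact Finset.mem_biUnion.2 ⟨m, hm, Finset.mem_filter.2 ⟨hx, h⟩⟩
  refine (Finset.card_le_card h).trans (Finset.card_biUnion_le.trans (Finset.sum_le_sum ?_))
  intro m _
  rw [← Set.ncard_coe_finset]
  refine Set.ncard_le_ncard ?_ (F.finite_toSet.subset Set.sdiff_subset)
  intro x hx
  obtain ⟨hx, h⟩ := Finset.mem_filter.1 (Finset.mem_coe.1 hx)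
  refine ⟨hx, ?_⟩
  rintro ⟨y, hy, rfl⟩
  simp at h
  exact h hy

theorem NUCA.IsFolnerNet.tendsto_boundary {G : Type*} [Group G] {ι : Type*} [Preorder ι]
    {F : ι → Finset G} (hF : IsFolnerNet F) (M : Finset G) :
    Tendsto (fun i => ((memoryBoundary M (F i)).card : ℝ) / ((F i).card : ℝ)) atTop (𝓝 0) := by
  have h := tendsto_finsetSum M fun m _ => hF.2 m⁻¹
  simp only [Finset.sum_const_zero] at h
  refine squeeze_zero (fun i => by positivity) (fun i => ?_) h
  rw [← Finset.sum_div]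
  gcongr
  exact_mod_cast card_memoryBoundary_le M (F i)

/-! ### Finite memory -/

/-- `τ x g` depends on the restriction of `x` to `gM` only. -/
def HasMemory {G A : Type*} [Group G] (M : Finset G) (τ : (G → A) → (G → A)) : Prop :=
  ∀ (x y : G → A) (g : G), (∀ m ∈ M, x (g * m) = y (g * m)) → τ x g = τ y g

theorem exists_hasMemory {G A : Type*} [Group G] {τ : (G → A) → (G → A)}
    (hτ : IsNUCAWithFiniteMemory τ) : ∃ M : Finset G, HasMemory M τ := by
  obtain ⟨M, s, hM, rfl⟩ := hτ
  refine ⟨hM.toFinset, fun x y g h => ?_⟩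
  unfold nuca
  congr 1
  funext m
  simpa [shift] using h m (by simp)

/-! ### Pre-injectivity and last cells -/

section Linear

variable {G K A : Type*} [Field K] [AddCommGroup A] [Module K A]

/-- For linear maps, pre-injectivity on a cylinder over `S` is a statement about the finitely
supported elements of the kernel that vanish on `S`, whatever the prescribed pattern is. -/
theorem preInjectiveOn_cylinder_iff (τ : (G → A) →ₗ[K] (G → A)) (S : Set G) (p : S → A) :
    PreInjectiveOn τ (cylinder S p) ↔
      ∀ z : G → A, (Function.support z).Finite → (∀ g ∈ S, z g = 0) → τ z = 0 → z = 0 := by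
  classical
  constructor
  · intro h z hz hS h0
    let x : G → A := fun g => if hg : g ∈ S then p ⟨g, hg⟩ else 0
    have hx : x ∈ cylinder S p := fun g => by simp [x]
    have := h (x + z) (fun g => by simp [hx g, hS g g.2]) x hx (by
      simpa [Asymptotic, Function.support] using hz) (by simp [h0])
    simpa using this
  · intro h x hx y hy hxy he
    refine sub_eq_zero.1 (h (x - y) ?_ (fun g hg => ?_) (by simp [he]))
    · simpa [Asymptotic, Function.support, sub_eq_zero] using hxy
    · simp [hx ⟨g, hg⟩, hy ⟨g, hg⟩]

/-- The last cells, with respect to the enumeration `e`, of the supports of the nonzero finitely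
supported elements of `Z`. -/
def leadingCells (e : G → ℕ) (Z : Submodule K (G → A)) : Set G :=
  {h | ∃ z ∈ Z, (Function.support z).Finite ∧ z h ≠ 0 ∧ ∀ k, e h < e k → z k = 0}

/-- Elements with distinct last cells in `W` have linearly independent restrictions to `W`. -/
theorem card_leadingCells_le_finrank [FiniteDimensional K A] {e : G → ℕ}
    (he : Function.Injective e) (Z : Submodule K (G → A)) (W : Finset G)
    [DecidablePred (· ∈ leadingCells e Z)] :
    (W.filter (· ∈ leadingCells e Z)).card ≤ Module.finrank K (restrictTo Z W) := by
  classical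
  set T := W.filter (· ∈ leadingCells e Z)
  have hT : ∀ t : T, t.1 ∈ W ∧ t.1 ∈ leadingCells e Z := fun t => Finset.mem_filter.1 t.2
  choose z hzZ _ hz0 hzlt using fun t : T => (hT t).2
  let v : T → restrictTo Z W := fun t =>
    ⟨LinearMap.funLeft K A Subtype.val (z t), z t, hzZ t, rfl⟩
  have hv : LinearIndependent K v := by
    rw [Fintype.linearIndependent_iff]
    intro c hc
    by_contra! hne
    obtain ⟨t, ht, hmax⟩ := Finset.exists_max_image
      (Finset.univ.filter fun t : T => c t ≠ 0) (fun t => e t.1)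
      (by simpa [Finset.Nonempty] using hne)
    have ht : c t ≠ 0 := by simpa using ht
    have h0 : ∑ s, c s • z s t.1 = 0 := by
      have := congrFun (congrArg Subtype.val hc) ⟨t.1, (hT t).1⟩
      simpa [v, LinearMap.funLeft_apply] using this
    rw [Finset.sum_eq_single t] at h0
    · exact (smul_ne_zero ht (hz0 t)) h0
    · intro s _ hst
      by_cases hs : c s = 0
      · simp [hs]
      · have hle := hmax s (by simpa using hs)
        have hne : e s.1 ≠ e t.1 := fun h => hst (Subtype.ext (he h))
        rw [hzlt s t.1 (lt_of_le_of_ne hle hne), smul_zero]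
    · simp
  simpa using hv.fintype_card_le_finrank

theorem preInjectiveOn_cylinder_leadingCells (e : G → ℕ) (τ : (G → A) →ₗ[K] (G → A))
    (p : leadingCells e (LinearMap.ker τ) → A) :
    PreInjectiveOn τ (cylinder (leadingCells e (LinearMap.ker τ)) p) := by
  rw [preInjectiveOn_cylinder_iff]
  intro z hz hS h0
  by_contra hne
  obtain ⟨h, hh, hmax⟩ := hz.exists_maximalFor e _ (Function.support_nonempty_iff.2 hne)
  refine hh (hS h ⟨z, h0, hz, hh, fun k hk => ?_⟩)
  by_contra hzk
  exact absurd (hmax hzk hk.le) (not_le.2 hk)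

/-! ### Dimension estimates in finite windows -/

/-- Extension by zero of a configuration on a finite set. -/
noncomputable def extendZero (K : Type*) {G A : Type*} [Field K] [AddCommGroup A] [Module K A]
    (F : Finset G) : (F → A) →ₗ[K] (G → A) where
  toFun u := Function.extend (Subtype.val : F → G) u 0
  map_add' u v := by simpa using Function.extend_add (Subtype.val : F → G) u v 0 0
  map_smul' c u := by simpa using Function.extend_smul c (Subtype.val : F → G) u 0

theorem extendZero_apply_coe (F : Finset G) (u : F → A) (g : F) : extendZero K F u g = u g :=
  Subtype.val_injective.extend_apply u 0 g

theorem extendZero_apply_of_notMem {F : Finset G} (u : F → A) {g : G} (hg : g ∉ F) :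
    extendZero K F u g = 0 :=
  Function.extend_apply' (f := (Subtype.val : F → G)) u 0 g (by simpa using hg)

variable [Group G]

theorem card_mul_finrank_le_finrank_restrictTo_range [FiniteDimensional K A] [DecidableEq G]
    {τ : (G → A) →ₗ[K] (G → A)} {M : Finset G} (hM : HasMemory M τ) {S : Set G} {p : S → A}
    (hS : PreInjectiveOn τ (cylinder S p)) (F : Finset G) [DecidablePred (· ∈ S)] :
    (F.card - (F.filter (· ∈ S)).card - (memoryBoundary (M.image (·⁻¹)) F).card : ℝ)
        * Module.finrank K A ≤ Module.finrank K (restrictTo (LinearMap.range τ) F) := by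
  rw [preInjectiveOn_cylinder_iff] at hS
  set D := F \ (F.filter (· ∈ S) ∪ memoryBoundary (M.image (·⁻¹)) F) with hD
  have hcard : (F.card - (F.filter (· ∈ S)).card - (memoryBoundary (M.image (·⁻¹)) F).card : ℝ)
      ≤ D.card := by
    have h1 := Finset.card_union_le (F.filter (· ∈ S)) (memoryBoundary (M.image (·⁻¹)) F)
    have h2 := Finset.le_card_sdiff (F.filter (· ∈ S) ∪ memoryBoundary (M.image (·⁻¹)) F) F
    have : F.card ≤ D.card + (F.filter (· ∈ S)).card
      + (memoryBoundary (M.image (·⁻¹)) F).card := by rw [← hD] at h2; omega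
    have : (F.card : ℝ) ≤ D.card + (F.filter (· ∈ S)).card
      + (memoryBoundary (M.image (·⁻¹)) F).card := by exact_mod_cast this
    linarith
  let L : (D → A) →ₗ[K] restrictTo (LinearMap.range τ) F :=
    ((LinearMap.funLeft K A (Subtype.val : F → G)) ∘ₗ τ ∘ₗ extendZero K D).codRestrict _
      fun u => ⟨_, ⟨_, rfl⟩, rfl⟩
  have hL : Function.Injective L := by
    rw [injective_iff_map_eq_zero]
    intro u hu
    have hsupp : ∀ g ∉ D, extendZero K D u g = 0 := fun g hg => extendZero_apply_of_notMem u hg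
    have hz : extendZero K D u = 0 := by
      refine hS _ (D.finite_toSet.subset fun g hg => ?_) (fun g hg => hsupp g ?_) ?_
      · by_contra h
        exact hg (hsupp g h)
      · simp +contextual [hD, hg]
      · funext g
        by_cases hg : g ∈ F
        · exact congrFun (congrArg Subtype.val hu) ⟨g, hg⟩
        · -- Outside `F` the cells of `gM` avoid `D`, as `D` omits the `M⁻¹`-boundary.
          rw [hM _ 0 g, map_zero]
          intro m hm
          refine hsupp _ fun h => ?_
          simp only [hD, Finset.mem_sdiff, Finset.mem_union, not_or] at h
          exact h.2.2 (mem_memoryBoundary.2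
            ⟨h.1, m⁻¹, Finset.mem_image_of_mem _ hm, by simpa using hg⟩)
    funext g
    simpa [hz] using (extendZero_apply_coe (K := K) D u g).symm
  have h := LinearMap.finrank_le_finrank_of_injective hL
  rw [Module.finrank_pi_fintype] at h
  simp only [Finset.sum_const, Finset.card_univ, Fintype.card_coe, smul_eq_mul] at h
  calc _ ≤ (D.card : ℝ) * Module.finrank K A := by gcongr
    _ ≤ _ := by exact_mod_cast h

/-- Rank-nullity in a finite window, with an error term for the boundary of the window. -/
theorem finrank_restrictTo_ker_add_range_le [FiniteDimensional K A]
    {τ : (G → A) →ₗ[K] (G → A)} {M : Finset G} (hM : HasMemory M τ) (W : Finset G) :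
    Module.finrank K (restrictTo (LinearMap.ker τ) W)
        + Module.finrank K (restrictTo (LinearMap.range τ) W)
      ≤ (W.card + (memoryBoundary M W).card) * Module.finrank K A := by
  classical
  let B := memoryBoundary M W
  -- On `W \ B` the value `τ x` depends on the restriction of `x` to `W` only; the second argument
  -- makes up for the values on `B`.
  let L : ((W → A) × (B → A)) →ₗ[K] (W → A) := LinearMap.coprod
    (LinearMap.pi fun w => if w.1 ∈ B then 0 else LinearMap.proj w.1 ∘ₗ τ ∘ₗ extendZero K W)
    (LinearMap.funLeft K A (Subtype.val : W → G) ∘ₗ extendZero K B)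
  have hloc : ∀ (x : G → A) (w : W), w.1 ∉ B →
      τ (extendZero K W (LinearMap.funLeft K A (Subtype.val : W → G) x)) w = τ x w := by
    intro x w hw
    refine hM _ _ _ fun m hm => ?_
    have hmem : w.1 * m ∈ W := by
      by_contra h
      exact hw (mem_memoryBoundary.2 ⟨w.2, m, hm, h⟩)
    exact extendZero_apply_coe (K := K) W _ ⟨_, hmem⟩
  have hrange : restrictTo (LinearMap.range τ) W ≤ LinearMap.range L := by
    rintro _ ⟨_, ⟨x, rfl⟩, rfl⟩
    refine ⟨(LinearMap.funLeft K A Subtype.val x, fun b => τ x b), ?_⟩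
    funext w
    by_cases hw : w.1 ∈ B
    · simpa [L, hw, LinearMap.funLeft_apply] using
        extendZero_apply_coe (K := K) B (fun b => τ x b) ⟨w.1, hw⟩
    · simp [L, hw, LinearMap.funLeft_apply, extendZero_apply_of_notMem, hloc x w hw]
  have hker : (restrictTo (LinearMap.ker τ) W).map (LinearMap.inl K (W → A) (B → A))
      ≤ LinearMap.ker L := by
    rintro _ ⟨_, ⟨x, hx, rfl⟩, rfl⟩
    have hx : τ x = 0 := hx
    rw [LinearMap.mem_ker]
    funext w
    by_cases hw : w.1 ∈ B
    · simp [L, hw]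
    · simp [L, hw, hloc x w hw, hx]
  have h1 := Submodule.finrank_mono hrange
  have h2 := Submodule.finrank_mono hker
  rw [(Submodule.equivMapOfInjective _ LinearMap.inl_injective _).symm.finrank_eq] at h2
  have h3 := L.finrank_range_add_finrank_ker
  rw [Module.finrank_prod, Module.finrank_pi_fintype, Module.finrank_pi_fintype] at h3
  simp only [Finset.sum_const, Finset.card_univ, Fintype.card_coe, smul_eq_mul] at h3
  change _ = _ + B.card * _ at h3
  rw [add_mul]
  change _ ≤ _ + B.card * _
  omega

theorem finrank_restrictTo_map_shift_le [FiniteDimensional K A] (X : Submodule K (G → A)) (g : G)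
    (F : Finset G) :
    Module.finrank K (restrictTo (X.map (shiftLinear K g⁻¹)) F)
      ≤ Module.finrank K (restrictTo X (F.map (mulLeftEmbedding g))) := by
  let φ : F → F.map (mulLeftEmbedding g) := fun f => ⟨g * f, by simp⟩
  have h : restrictTo (X.map (shiftLinear K g⁻¹)) F
      = (restrictTo X (F.map (mulLeftEmbedding g))).map (LinearMap.funLeft K A φ) := by
    unfold restrictTo
    rw [← Submodule.map_comp, ← Submodule.map_comp]
    congr 1
    ext x f
    change x (g⁻¹⁻¹ * f) = x (g * f)
    rw [inv_inv]
  rw [h]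
  exact Submodule.finrank_map_le _ _

end Linear

/-! ### Densities -/

section Density

variable {G : Type*} [Group G]

theorem ncard_inter_image_mulLeft (S : Set G) (g : G) (F : Finset G)
    [DecidablePred (fun x => g * x ∈ S)] :
    (S ∩ ((fun h => g * h) '' (F : Set G))).ncard = (F.filter fun x => g * x ∈ S).card := by
  have h : S ∩ ((fun h => g * h) '' (F : Set G))
      = (fun h => g * h) '' (F.filter fun x => g * x ∈ S : Finset G) := by
    ext x
    simp only [Set.mem_inter_iff, Set.mem_image, Finset.mem_coe, Finset.mem_filter]
    grind
  rw [h, Set.ncard_image_of_injective _ (mul_right_injective g), Set.ncard_coe_finset]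

/-- If `S` has density at most `d` in every translate of `F`, then it has density at most `d` in
every finite set, up to the boundary: count the pairs `(x, f)` in `E × F` with `g x f ∈ S`. -/
theorem card_filter_le_of_forall_card_le [DecidableEq G] {S : Set G} [DecidablePred (· ∈ S)]
    {F : Finset G} (hF : F.Nonempty) {d : ℝ}
    (hd : ∀ g : G, ((F.filter fun x => g * x ∈ S).card : ℝ) ≤ d * F.card) (E : Finset G) (g : G) :
    ((E.filter fun x => g * x ∈ S).card : ℝ)
      ≤ d * E.card + (memoryBoundary (F.image (·⁻¹)) E).card := by
  set B := memoryBoundary (F.image (·⁻¹)) E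
  have h1 : ∀ f ∈ F, (E.filter fun x => g * x ∈ S).card
      ≤ B.card + (E.filter fun x => g * x * f ∈ S).card := by
    intro f hf
    have hsub : (E.filter fun x => g * x ∈ S)
        ⊆ B ∪ (E.filter fun x => g * x * f ∈ S).image (· * f) := by
      intro x hx
      obtain ⟨hxE, hxS⟩ := Finset.mem_filter.1 hx
      by_cases hxB : x ∈ B
      · exact Finset.mem_union_left _ hxB
      · refine Finset.mem_union_right _ (Finset.mem_image.2 ⟨x * f⁻¹, ?_, by simp⟩)
        refine Finset.mem_filter.2 ⟨?_, by simpa [mul_assoc] using hxS⟩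
        by_contra h
        exact hxB (mem_memoryBoundary.2 ⟨hxE, f⁻¹, Finset.mem_image_of_mem _ hf, h⟩)
    exact (Finset.card_le_card hsub).trans ((Finset.card_union_le _ _).trans
      (Nat.add_le_add_left Finset.card_image_le _))
  have h2 : ∑ f ∈ F, (E.filter fun x => g * x * f ∈ S).card
      = ∑ x ∈ E, (F.filter fun f => g * x * f ∈ S).card := by
    simp only [Finset.card_filter]
    exact Finset.sum_comm
  have h3 : ((∑ x ∈ E, (F.filter fun f => g * x * f ∈ S).card : ℕ) : ℝ)
      ≤ E.card * (d * F.card) := by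
    push_cast
    simpa using Finset.sum_le_card_nsmul E _ _ fun x _ => hd (g * x)
  have h4 : F.card * (E.filter fun x => g * x ∈ S).card
      ≤ F.card * B.card + ∑ f ∈ F, (E.filter fun x => g * x * f ∈ S).card := by
    simpa [Finset.sum_add_distrib] using Finset.sum_le_sum h1
  rw [h2] at h4
  have h5 : (F.card : ℝ) * (E.filter fun x => g * x ∈ S).card
      ≤ F.card * B.card + ((∑ x ∈ E, (F.filter fun f => g * x * f ∈ S).card : ℕ) : ℝ) := by
    exact_mod_cast h4
  have hpos : (0 : ℝ) < F.card := by exact_mod_cast hF.card_pos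
  refine le_of_mul_le_mul_left ?_ hpos
  linarith

theorem upperBanachDensity_le_of_forall_card_le {S : Set G} [DecidablePred (· ∈ S)]
    {F : Finset G} (hF : F.Nonempty) {d : ℝ}
    (hd : ∀ g : G, ((F.filter fun x => g * x ∈ S).card : ℝ) ≤ d * F.card)
    {κ : Type*} [Preorder κ] [IsDirectedOrder κ] [Nonempty κ] {E : κ → Finset G}
    (hE : IsFolnerNet E) : upperBanachDensity E S ≤ d := by
  classical
  have hlim : Tendsto (fun i => d + ((memoryBoundary (F.image (·⁻¹)) (E i)).card : ℝ)
      / ((E i).card : ℝ)) atTop (𝓝 d) := by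
    simpa using (hE.tendsto_boundary (F.image (·⁻¹))).const_add d
  rw [← hlim.liminf_eq]
  refine liminf_le_liminf (Eventually.of_forall fun i => ciSup_le fun g => ?_) ?_
    hlim.isCoboundedUnder_ge
  · have hpos : (0 : ℝ) < (E i).card := by exact_mod_cast (hE.1 i).card_pos
    rw [ncard_inter_image_mulLeft, div_le_iff₀ hpos, add_mul, div_mul_cancel₀ _ hpos.ne']
    exact card_filter_le_of_forall_card_le hF hd (E i) g
  · exact isBoundedUnder_of ⟨0, fun i => Real.iSup_nonneg fun g => by positivity⟩

end Density

/-! ### The two inequalities -/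

theorem le_upperMeanDim_of_preInjectiveOn {G K A : Type*} [Group G] [Field K] [AddCommGroup A]
    [Module K A] [FiniteDimensional K A] {τ : (G → A) →ₗ[K] (G → A)}
    (hτ : IsNUCAWithFiniteMemory τ) {S : Set G} {p : S → A}
    (hS : PreInjectiveOn τ (cylinder S p)) {ι : Type*} [Preorder ι] [IsDirectedOrder ι] [Nonempty ι]
    {F : ι → Finset G} (hF : IsFolnerNet F) :
    (1 - upperDensity F S) * (Module.finrank K A : ℝ) ≤ upperMeanDim F (LinearMap.range τ) := by
  classical
  obtain ⟨M, hM⟩ := exists_hasMemory hτ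
  set a : ℝ := (Module.finrank K A : ℝ) with ha_def
  have hpos : ∀ i, (0 : ℝ) < (F i).card := fun i => by exact_mod_cast (hF.1 i).card_pos
  have hbdd : ∀ i, (Module.finrank K (restrictTo (LinearMap.range τ) (F i)) : ℝ) / (F i).card
      ≤ a := by
    intro i
    rw [div_le_iff₀ (hpos i)]
    have h := Submodule.finrank_le (restrictTo (LinearMap.range τ) (F i))
    rw [Module.finrank_pi_fintype] at h
    simp only [Finset.sum_const, Finset.card_univ, Fintype.card_coe, smul_eq_mul] at h
    rw [mul_comm] at h
    rw [ha_def]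
    exact_mod_cast h
  have hdens : ∀ i, ((S ∩ (F i : Set G)).ncard : ℝ) / (F i).card ≤ 1 := by
    intro i
    rw [div_le_one (hpos i), ← Set.ncard_coe_finset (F i)]
    exact_mod_cast Set.ncard_le_ncard Set.inter_subset_right (F i).finite_toSet
  have hlim : Tendsto (fun i => ((memoryBoundary (M.image (·⁻¹)) (F i)).card : ℝ)
      / ((F i).card : ℝ) * a) atTop (𝓝 0) := by
    simpa using (hF.tendsto_boundary (M.image (·⁻¹))).mul_const a
  refine le_of_forall_pos_lt_add fun ε hε => ?_
  -- `η` bounds the error made in the density, scaled so that `η * a < ε / 2` even if `a = 0`.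
  obtain ⟨η, hη, hηa⟩ : ∃ η : ℝ, 0 < η ∧ η * a < ε / 2 := by
    have ha : 0 ≤ a := Nat.cast_nonneg _
    refine ⟨ε / 2 / (a + 1), by positivity, ?_⟩
    rw [div_mul_eq_mul_div, div_lt_iff₀ (by positivity)]
    nlinarith
  have hev1 := eventually_lt_of_limsup_lt (lt_add_of_pos_right (upperDensity F S) hη)
    (isBoundedUnder_of ⟨1, hdens⟩)
  have hev2 := hlim.eventually_lt_const (half_pos hε)
  have hle : (1 - upperDensity F S) * a - ε / 2 - η * a ≤ upperMeanDim F (LinearMap.range τ) := by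
    refine le_limsup_of_frequently_le (Eventually.frequently ?_) (isBoundedUnder_of ⟨a, hbdd⟩)
    filter_upwards [hev1, hev2] with i h1 h2
    have hkey := card_mul_finrank_le_finrank_restrictTo_range hM hS (F i)
    have hS' : ((S ∩ (F i : Set G)).ncard : ℝ) = ((F i).filter (· ∈ S)).card := by
      rw [← Set.ncard_coe_finset, Finset.coe_filter, Set.inter_comm]
      rfl
    rw [hS'] at h1
    have hkey' := div_le_div_of_nonneg_right hkey (hpos i).le
    have hsplit : (((F i).card : ℝ) - ((F i).filter (· ∈ S)).card
        - (memoryBoundary (M.image (·⁻¹)) (F i)).card) * a / (F i).card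
        = (1 - ((F i).filter (· ∈ S)).card / (F i).card) * a
          - (memoryBoundary (M.image (·⁻¹)) (F i)).card / (F i).card * a := by
      have := (hpos i).ne'
      field_simp
    rw [hsplit] at hkey'
    have ha : 0 ≤ a := Nat.cast_nonneg _
    nlinarith [mul_le_mul_of_nonneg_right h1.le ha]
  linarith

theorem exists_upperBanachDensity_le_preInjectiveOn {G K A : Type*} [Group G] [Countable G]
    [Field K] [AddCommGroup A] [Module K A] [FiniteDimensional K A] {τ : (G → A) →ₗ[K] (G → A)}
    (hτ : IsNUCAWithFiniteMemory τ) (hA : Module.finrank K A = 1) {d : ℝ} {ι : Type*}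
    [Preorder ι] [IsDirectedOrder ι] [Nonempty ι] {F : ι → Finset G} (hF : IsFolnerNet F)
    (hd : 1 - d < lowerBanachMeanDim F (LinearMap.range τ)) :
    ∃ S : Set G,
      (∀ (κ : Type v) [Preorder κ] [IsDirectedOrder κ] [Nonempty κ] (E : κ → Finset G),
        IsFolnerNet E → upperBanachDensity E S ≤ d) ∧
      PreInjectiveOn τ (cylinder S (fun _ => (0 : A))) := by
  classical
  obtain ⟨M, hM⟩ := exists_hasMemory hτ
  obtain ⟨e, he⟩ := exists_injective_nat G
  refine ⟨leadingCells e (LinearMap.ker τ), ?_, preInjectiveOn_cylinder_leadingCells e τ _⟩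
  obtain ⟨c, hdc, hc⟩ := exists_between hd
  have hbelow : ∀ i, BddBelow (Set.range fun g : G =>
      (Module.finrank K (restrictTo ((LinearMap.range τ).map (shiftLinear K g)) (F i)) : ℝ)
        / ((F i).card : ℝ)) := fun i => ⟨0, by rintro _ ⟨g, rfl⟩; positivity⟩
  have hfreq := frequently_lt_of_lt_limsup (isCoboundedUnder_le_of_le atTop (x := 0)
    fun i => Real.iInf_nonneg fun g => by positivity) hc
  have hev := (hF.tendsto_boundary M).eventually_lt_const (sub_pos.2 hdc)
  obtain ⟨i, hi, hbd⟩ := (hfreq.and_eventually hev).exists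
  have hpos : (0 : ℝ) < (F i).card := by exact_mod_cast (hF.1 i).card_pos
  intro κ _ _ _ E hE
  refine upperBanachDensity_le_of_forall_card_le (hF.1 i) (fun g => ?_) hE
  set W := (F i).map (mulLeftEmbedding g) with hW
  have h1 := card_leadingCells_le_finrank he (LinearMap.ker τ) W
  have h2 := finrank_restrictTo_ker_add_range_le hM W
  have h3 := finrank_restrictTo_map_shift_le (LinearMap.range τ) g (F i)
  have h4 := hi.trans_le (ciInf_le (hbelow i) g⁻¹)
  rw [lt_div_iff₀ hpos] at h4
  rw [div_lt_iff₀ hpos] at hbd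
  rw [hA, mul_one, hW, card_memoryBoundary_map_mulLeft, Finset.card_map, ← hW] at h2
  have h5 : (W.filter (· ∈ leadingCells e (LinearMap.ker τ))).card
      = ((F i).filter fun x => g * x ∈ leadingCells e (LinearMap.ker τ)).card := by
    rw [hW, Finset.filter_map, Finset.card_map]
    rfl
  rw [h5] at h1
  have h6 : ((((F i).filter fun x => g * x ∈ leadingCells e (LinearMap.ker τ)).card : ℕ) : ℝ)
      + Module.finrank K (restrictTo ((LinearMap.range τ).map (shiftLinear K g⁻¹)) (F i))
      ≤ (F i).card + (memoryBoundary M (F i)).card := by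
    exact_mod_cast (Nat.add_le_add h1 h3).trans h2
  linarith

theorem theoremC {G : Type u} [Group G] [Infinite G] [Countable G] (hG : NUCA.IsAmenable G)
    {K : Type*} [Field K] {A : Type*} [AddCommGroup A] [Module K A] [FiniteDimensional K A]
    (τ : (G → A) →ₗ[K] (G → A)) (hτ : NUCA.IsNUCAWithFiniteMemory (⇑τ)) :
    (∀ (S : Set G) (p : S → A), NUCA.PreInjectiveOn (⇑τ) (NUCA.cylinder S p) →
      ∀ (ι : Type v) [Preorder ι] [IsDirectedOrder ι] [Nonempty ι] (F : ι → Finset G),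
        NUCA.IsFolnerNet F →
        (1 - NUCA.upperDensity F S) * (Module.finrank K A : ℝ)
          ≤ NUCA.upperMeanDim F (LinearMap.range τ)) ∧
    (Module.finrank K A = 1 →
      ∀ (d : ℝ) (ι : Type v) [Preorder ι] [IsDirectedOrder ι] [Nonempty ι] (F : ι → Finset G),
        NUCA.IsFolnerNet F →
        1 - d < NUCA.lowerBanachMeanDim F (LinearMap.range τ) →
        ∃ S : Set G,
          (∀ (κ : Type v) [Preorder κ] [IsDirectedOrder κ] [Nonempty κ] (E : κ → Finset G),
            NUCA.IsFolnerNet E → NUCA.upperBanachDensity E S ≤ d) ∧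
          NUCA.PreInjectiveOn (⇑τ) (NUCA.cylinder S (fun _ => (0 : A)))) := by
  refine ⟨fun S p hS ι _ _ _ F hF => le_upperMeanDim_of_preInjectiveOn hτ hS hF, ?_⟩
  intro hA d ι _ _ _ F hF hd
  exact exists_upperBanachDensity_le_preInjectiveOn hτ hA hF hd
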